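/- Let $n,d\ge 0$, let $f=l_1\cdots l_d$ be a product of nonzero homogeneous linear forms on $\mathbb{C}^n$ (repetitions and proportional forms are allowed, so the central arrangement may be non-reduced), let $F=(l_1,\dots,l_d)$, and let $\mathbf{a}=(a_1,\dots,a_d)\in\mathbb{N}^d$, where $0\in\mathbb{N}$. Write $\mathbb{C}[S]=\mathbb{C}[s_1,\dots,s_d]$ and let $A_n[S]$ be the Weyl algebra in $n$ variables with the central variables $s_1,\dots,s_d$ adjoined. It acts on the free rank-one module $\mathbb{C}[x_1,\dots,x_n][1/f][S]\cdot F^S$ with basis $F^S=l_1^{s_1}\cdots l_d^{s_d}$ by the product and chain rules, i.e. $\partial_i(uF^S)=\big(\tfrac{\partial u}{\partial x_i}+u\sum_k s_k\tfrac{\partial l_k/\partial x_i}{l_k}\big)F^S$. Put $F^{S+\mathbf{a}}=l_1^{a_1}\cdots l_d^{a_d}F^S$ and let $$B_F^{\mathbf{a}}=\{\,b\in\mathbb{C}[S] : b\,F^S\in A_n[S]\,F^{S+\mathbf{a}}\,\}$$ be the Bernstein–Sato ideal. Let the edges be all intersections $X=\bigcap_{i\in I}\{l_i=0\}$, $I\subseteq\{1,\dots,d\}$;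 let $r(X)$ be the codimension of $X$ and $J(X)=\{\,j : X\subseteq\{l_j=0\}\,\}$. An edge $X$ is decomposable if, for some linear coordinates $y_1,\dots,y_{r(X)}$ on $\mathbb{C}^n/X\cong\mathbb{C}^{r(X)}$ and some partition of them into two nonempty sets, each form $l_j$, $j\in J(X)$, involves only variables from one of the two sets (that is, $f_X=\prod_{j\in J(X)}l_j$ is a product of two arrangements in disjoint nonempty sets of variables). An edge $X\neq\mathbb{C}^n$ that is not decomposable is called indecomposable; the edge $\mathbb{C}^n$ is not counted as indecomposable. Then there exists $N\in\mathbb{N}$ such that $$\prod_{X\text{ indecomposable edge}}\ \prod_{\ell=0}^{N}\Big(\sum_{j\in J(X)}s_j+r(X)+\ell\Big)\in B_F^{\mathbf{a}}.$$ -/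

import Mathlib

namespace BernsteinSato

open MvPolynomial

/-! ### The Weyl algebra -/

/-- The defining relations of the Weyl algebra in `n` variables; `Sum.inl i` stands for `x_i` and
`Sum.inr i` for `∂_i`. -/
inductive WeylRel (R : Type) [CommRing R] (n : ℕ) :
    FreeAlgebra R (Fin n ⊕ Fin n) → FreeAlgebra R (Fin n ⊕ Fin n) → Prop
  | x_comm (i j : Fin n) : WeylRel R n
      (FreeAlgebra.ι R (Sum.inl i) * FreeAlgebra.ι R (Sum.inl j))
      (FreeAlgebra.ι R (Sum.inl j) * FreeAlgebra.ι R (Sum.inl i))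
  | d_comm (i j : Fin n) : WeylRel R n
      (FreeAlgebra.ι R (Sum.inr i) * FreeAlgebra.ι R (Sum.inr j))
      (FreeAlgebra.ι R (Sum.inr j) * FreeAlgebra.ι R (Sum.inr i))
  | d_x (i j : Fin n) : WeylRel R n
      (FreeAlgebra.ι R (Sum.inr i) * FreeAlgebra.ι R (Sum.inl j))
      (FreeAlgebra.ι R (Sum.inl j) * FreeAlgebra.ι R (Sum.inr i) + if i = j then 1 else 0)

/-- The Weyl algebra in `n` variables over a commutative ring `R`. Over `R = ℂ[s_1, …, s_r]` this is
the Weyl algebra over `ℂ` with the central variables `s_1, …, s_r` adjoined. -/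
abbrev Weyl (R : Type) [CommRing R] (n : ℕ) : Type := RingQuot (WeylRel R n)

/-- The polynomial ring `ℂ[s_1, …, s_r]`. -/
abbrev PolyS (r : ℕ) : Type := MvPolynomial (Fin r) ℂ

/-- The polynomial ring `ℂ[s_1, …, s_r][x_1, …, x_n]`. -/
abbrev PolySX (n r : ℕ) : Type := MvPolynomial (Fin n) (PolyS r)

/-! ### Extending a derivation to a localization by the quotient rule -/

section Localization

variable {R A : Type} [CommRing R] [CommRing A] [Algebra R A]

theorem algebraMap_smul_aux (f : A) (c : R) (g : A) :
    algebraMap A (Localization.Away f) (c • g) = c • algebraMap A (Localization.Away f) g :=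
  (Algebra.linearMap A (Localization.Away f)).map_smul_of_tower c g

/-- The homomorphism `g ↦ g + ε D(g)` from `A` to the dual numbers over `A[1/f]`. -/
noncomputable def dualLift (D : Derivation R A A) (f : A) :
    A →ₐ[R] TrivSqZeroExt (Localization.Away f) (Localization.Away f) :=
  AlgHom.ofLinearMap
    { toFun := fun g => TrivSqZeroExt.inl (algebraMap A (Localization.Away f) g) +
        TrivSqZeroExt.inr (algebraMap A (Localization.Away f) (D g))
      map_add' := fun g h => by
        ext
        · simp only [TrivSqZeroExt.fst_add, TrivSqZeroExt.fst_inl, TrivSqZeroExt.fst_inr, map_add,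
            add_zero]
        · simp only [TrivSqZeroExt.snd_add, TrivSqZeroExt.snd_inl, TrivSqZeroExt.snd_inr, map_add,
            zero_add]
      map_smul' := fun c g => by
        ext
        · simp only [TrivSqZeroExt.fst_add, TrivSqZeroExt.fst_inl, TrivSqZeroExt.fst_inr,
            TrivSqZeroExt.fst_smul, add_zero, RingHom.id_apply,
            algebraMap_smul_aux]
        · simp only [TrivSqZeroExt.snd_add, TrivSqZeroExt.snd_inl, TrivSqZeroExt.snd_inr,
            TrivSqZeroExt.snd_smul, zero_add, RingHom.id_apply, Derivation.map_smul,
            algebraMap_smul_aux] }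
    (by
      simp only [LinearMap.coe_mk, AddHom.coe_mk, map_one, Derivation.map_one_eq_zero, map_zero,
        TrivSqZeroExt.inr_zero, add_zero, TrivSqZeroExt.inl_one])
    (fun g h => by
      simp only [LinearMap.coe_mk, AddHom.coe_mk]
      ext
      · simp only [TrivSqZeroExt.fst_add, TrivSqZeroExt.fst_inl, TrivSqZeroExt.fst_inr,
          TrivSqZeroExt.fst_mul, add_zero, map_mul]
      · simp only [TrivSqZeroExt.fst_add, TrivSqZeroExt.snd_add, TrivSqZeroExt.fst_inl,
          TrivSqZeroExt.fst_inr, TrivSqZeroExt.snd_inl, TrivSqZeroExt.snd_inr,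
          TrivSqZeroExt.snd_mul, add_zero, zero_add, Derivation.leibniz, smul_eq_mul, map_add,
          map_mul, MulOpposite.smul_eq_mul_unop, MulOpposite.unop_op]
        ring)

theorem dualLift_fst (D : Derivation R A A) (f g : A) :
    (dualLift D f g).fst = algebraMap A (Localization.Away f) g := by
  change (TrivSqZeroExt.inl _ + TrivSqZeroExt.inr _ :
    TrivSqZeroExt (Localization.Away f) (Localization.Away f)).fst = _
  simp only [TrivSqZeroExt.fst_add, TrivSqZeroExt.fst_inl, TrivSqZeroExt.fst_inr, add_zero]

theorem dualLift_snd (D : Derivation R A A) (f g : A) :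
    (dualLift D f g).snd = algebraMap A (Localization.Away f) (D g) := by
  change (TrivSqZeroExt.inl _ + TrivSqZeroExt.inr _ :
    TrivSqZeroExt (Localization.Away f) (Localization.Away f)).snd = _
  simp only [TrivSqZeroExt.snd_add, TrivSqZeroExt.snd_inl, TrivSqZeroExt.snd_inr, zero_add]

theorem dualLift_isUnit (D : Derivation R A A) (f : A) (y : Submonoid.powers f) :
    IsUnit (dualLift D f y) := by
  rw [TrivSqZeroExt.isUnit_iff_isUnit_fst, dualLift_fst]
  exact IsLocalization.map_units (Localization.Away f) y

/-- The homomorphism `u ↦ u + ε D(u)` from `A[1/f]` to the dual numbers over `A[1/f]`. -/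
noncomputable def locLift (D : Derivation R A A) (f : A) :
    Localization.Away f →ₐ[R] TrivSqZeroExt (Localization.Away f) (Localization.Away f) :=
  IsLocalization.liftAlgHom (M := Submonoid.powers f) (f := dualLift D f) (dualLift_isUnit D f)

theorem locLift_algebraMap (D : Derivation R A A) (f g : A) :
    locLift D f (algebraMap A (Localization.Away f) g) = dualLift D f g := by
  simp [locLift]

theorem locLift_fst (D : Derivation R A A) (f : A) (u : Localization.Away f) :
    (locLift D f u).fst = u := by
  have h : ((TrivSqZeroExt.fstHom R (Localization.Away f) (Localization.Away f)).comp
      (locLift D f) : Localization.Away f →+* Localization.Away f) = RingHom.id _ := by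
    apply IsLocalization.ringHom_ext (Submonoid.powers f)
    ext g
    simp [locLift_algebraMap, dualLift_fst]
  exact DFunLike.congr_fun h u

/-- The extension of a derivation `D` of `A` to `A[1/f]`. -/
noncomputable def locDer (D : Derivation R A A) (f : A) :
    Derivation R (Localization.Away f) (Localization.Away f) :=
  Derivation.mk'
    { toFun := fun u => (locLift D f u).snd
      map_add' := fun u v => by simp
      map_smul' := fun c u => by simp }
    (fun u v => by simp [locLift_fst, mul_comm])

theorem locDer_algebraMap (D : Derivation R A A) (f g : A) :
    locDer D f (algebraMap A (Localization.Away f) g) =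
      algebraMap A (Localization.Away f) (D g) := by
  simp [locDer, locLift_algebraMap, dualLift_snd]

theorem der_ext {f : A} {D₁ D₂ : Derivation R (Localization.Away f) (Localization.Away f)}
    (h : ∀ g : A, D₁ (algebraMap A _ g) = D₂ (algebraMap A _ g)) : D₁ = D₂ := by
  ext u
  obtain ⟨⟨g, y⟩, hu⟩ := IsLocalization.surj (Submonoid.powers f) u
  have e₁ := congrArg D₁ hu
  have e₂ := congrArg D₂ hu
  simp only [Derivation.leibniz, h, smul_eq_mul] at e₁ e₂
  have hy := IsLocalization.map_units (Localization.Away f) y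
  refine hy.mul_left_cancel ?_
  linear_combination e₁ - e₂

theorem locDer_comm (D₁ D₂ : Derivation R A A) (f : A) (h : ∀ g, D₁ (D₂ g) = D₂ (D₁ g))
    (u : Localization.Away f) :
    locDer D₁ f (locDer D₂ f u) = locDer D₂ f (locDer D₁ f u) := by
  have : ⁅locDer D₁ f, locDer D₂ f⁆ = 0 := by
    apply der_ext
    intro g
    simp [Derivation.commutator_apply, locDer_algebraMap, h]
  have := DFunLike.congr_fun this u
  rwa [Derivation.commutator_apply, Derivation.zero_apply, sub_eq_zero] at this

end Localization

/-! ### The module `ℂ[S][x, 1/f] F^S`, its action of the Weyl algebra, Bernstein–Sato ideals -/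

section Module

variable {n r : ℕ}

/-- `f_k`, viewed in `ℂ[S][x]`. -/
noncomputable def toSX (g : MvPolynomial (Fin n) ℂ) : PolySX n r := MvPolynomial.map C g

/-- The ring `ℂ[S][x, 1/f]`, `f = f_1 ⋯ f_r`. An element `u` of it stands for the element `u F^S`
of the free module of rank one with basis `F^S = f_1^{s_1} ⋯ f_r^{s_r}`. -/
abbrev LocRing (F : Fin r → MvPolynomial (Fin n) ℂ) : Type :=
  Localization.Away (∏ k, toSX (F k) : PolySX n r)

/-- `∂/∂x_i` on `ℂ[S][x, 1/f]`. -/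
noncomputable def partialD (F : Fin r → MvPolynomial (Fin n) ℂ) (i : Fin n) :
    Derivation (PolyS r) (LocRing F) (LocRing F) :=
  locDer (pderiv i) _

/-- `f_k` in `ℂ[S][x, 1/f]`. -/
noncomputable def elt (F : Fin r → MvPolynomial (Fin n) ℂ) (k : Fin r) : LocRing F :=
  algebraMap (PolySX n r) (LocRing F) (toSX (F k))

theorem elt_isUnit (F : Fin r → MvPolynomial (Fin n) ℂ) (k : Fin r) : IsUnit (elt F k) := by
  have h := IsLocalization.Away.algebraMap_isUnit (S := LocRing F)
    (∏ k, toSX (F k) : PolySX n r)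
  exact isUnit_of_dvd_unit
    (map_dvd _ (Finset.dvd_prod_of_mem (fun k => toSX (F k)) (Finset.mem_univ k))) h

/-- The logarithmic derivative `(∂F^S/∂x_i) / F^S = ∑_k s_k (∂f_k/∂x_i) / f_k`. -/
noncomputable def logD (F : Fin r → MvPolynomial (Fin n) ℂ) (i : Fin n) : LocRing F :=
  ∑ k, algebraMap (PolyS r) (LocRing F) (X k) * (partialD F i (elt F k) * Ring.inverse (elt F k))

theorem partialD_comm (F : Fin r → MvPolynomial (Fin n) ℂ) (i j : Fin n) (u : LocRing F) :
    partialD F i (partialD F j u) = partialD F j (partialD F i u) := by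
  refine locDer_comm _ _ _ (fun g => ?_) u
  have : ⁅(pderiv i : Derivation (PolyS r) (PolySX n r) (PolySX n r)),
      (pderiv j : Derivation (PolyS r) (PolySX n r) (PolySX n r))⁆ = 0 := by
    apply MvPolynomial.derivation_ext
    intro k
    classical
    simp only [Derivation.commutator_apply, pderiv_X, Derivation.zero_apply]
    rcases eq_or_ne k i with rfl | hi <;> rcases eq_or_ne k j with rfl | hj <;>
      simp_all
  have := DFunLike.congr_fun this g
  rwa [Derivation.commutator_apply, Derivation.zero_apply, sub_eq_zero] at this

theorem partialD_inverse (F : Fin r → MvPolynomial (Fin n) ℂ) (i : Fin n) (k : Fin r) :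
    partialD F i (Ring.inverse (elt F k)) =
      - (Ring.inverse (elt F k)) ^ 2 * partialD F i (elt F k) := by
  have h : elt F k * Ring.inverse (elt F k) = 1 := Ring.mul_inverse_cancel _ (elt_isUnit F k)
  have e := congrArg (partialD F i) h
  simp only [Derivation.leibniz, smul_eq_mul, Derivation.map_one_eq_zero] at e
  refine (elt_isUnit F k).mul_left_cancel ?_
  linear_combination e + (Ring.inverse (elt F k)) * partialD F i (elt F k) * h

theorem partialD_logD (F : Fin r → MvPolynomial (Fin n) ℂ) (i j : Fin n) :
    partialD F i (logD F j) = partialD F j (logD F i) := by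
  simp only [logD, map_sum]
  refine Finset.sum_congr rfl fun k _ => ?_
  simp only [Derivation.leibniz, smul_eq_mul, Derivation.map_algebraMap, partialD_inverse,
    partialD_comm F i j]
  ring

/-- The action of `∂_i` on `u F^S` given by the product and chain rules:
`∂_i (u F^S) = (∂u/∂x_i + u ∑_k s_k (∂f_k/∂x_i) / f_k) F^S`. -/
noncomputable def nabla (F : Fin r → MvPolynomial (Fin n) ℂ) (i : Fin n) :
    Module.End (PolyS r) (LocRing F) :=
  (partialD F i).toLinearMap + LinearMap.mulLeft (PolyS r) (logD F i)

theorem nabla_apply (F : Fin r → MvPolynomial (Fin n) ℂ) (i : Fin n) (u : LocRing F) :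
    nabla F i u = partialD F i u + logD F i * u := rfl

/-- Multiplication by `x_i`. -/
noncomputable def mulX (F : Fin r → MvPolynomial (Fin n) ℂ) (i : Fin n) :
    Module.End (PolyS r) (LocRing F) :=
  LinearMap.mulLeft (PolyS r) (algebraMap (PolySX n r) (LocRing F) (X i))

theorem mulX_apply (F : Fin r → MvPolynomial (Fin n) ℂ) (i : Fin n) (u : LocRing F) :
    mulX F i u = algebraMap (PolySX n r) (LocRing F) (X i) * u := rfl

theorem act_rel (F : Fin r → MvPolynomial (Fin n) ℂ) ⦃P Q : FreeAlgebra (PolyS r) (Fin n ⊕ Fin n)⦄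
    (h : WeylRel (PolyS r) n P Q) :
    FreeAlgebra.lift (PolyS r) (Sum.elim (mulX F) (nabla F)) P =
      FreeAlgebra.lift (PolyS r) (Sum.elim (mulX F) (nabla F)) Q := by
  cases h with
  | x_comm i j =>
    ext u
    simp only [map_mul, FreeAlgebra.lift_ι_apply, Sum.elim_inl, Module.End.mul_apply, mulX_apply]
    ring
  | d_comm i j =>
    ext u
    simp only [map_mul, FreeAlgebra.lift_ι_apply, Sum.elim_inr, Module.End.mul_apply, nabla_apply,
      map_add, Derivation.leibniz, smul_eq_mul, partialD_comm F i j, partialD_logD F i j]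
    ring
  | d_x i j =>
    ext u
    have hx : partialD F i (algebraMap (PolySX n r) (LocRing F) (X j)) = if i = j then 1 else 0 := by
      rw [partialD, locDer_algebraMap, pderiv_X]
      rcases eq_or_ne i j with rfl | hij
      · simp
      · simp [hij, hij.symm]
    rcases eq_or_ne i j with rfl | hij
    · simp only [map_mul, map_add, FreeAlgebra.lift_ι_apply, Sum.elim_inr, Sum.elim_inl,
        Module.End.mul_apply, LinearMap.add_apply, nabla_apply, mulX_apply, map_one,
        Derivation.leibniz, smul_eq_mul, hx, if_true, Module.End.one_apply]
      ring
    · simp only [map_mul, map_add, FreeAlgebra.lift_ι_apply, Sum.elim_inr, Sum.elim_inl,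
        Module.End.mul_apply, LinearMap.add_apply, nabla_apply, mulX_apply, map_zero,
        Derivation.leibniz, smul_eq_mul, hx, if_neg hij, LinearMap.zero_apply]
      ring

/-- The action of the Weyl algebra over `ℂ[S]` on `ℂ[S][x, 1/f] F^S`. -/
noncomputable def weylAct (F : Fin r → MvPolynomial (Fin n) ℂ) :
    Weyl (PolyS r) n →ₐ[PolyS r] Module.End (PolyS r) (LocRing F) :=
  RingQuot.liftAlgHom (PolyS r)
    ⟨FreeAlgebra.lift (PolyS r) (Sum.elim (mulX F) (nabla F)), act_rel F⟩

/-- `F^{S+a} = f_1^{a_1} ⋯ f_r^{a_r} F^S`; in particular `F^S` itself is `powS F 0`. -/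
noncomputable def powS (F : Fin r → MvPolynomial (Fin n) ℂ) (a : Fin r → ℕ) : LocRing F :=
  ∏ k, elt F k ^ a k

/-- The Bernstein–Sato ideal `B_F^a`: all `b ∈ ℂ[S]` such that `b F^S = P F^{S+a}` for some `P` in
the Weyl algebra over `ℂ[S]`. -/
noncomputable def bsIdeal (F : Fin r → MvPolynomial (Fin n) ℂ) (a : Fin r → ℕ) :
    Ideal (PolyS r) where
  carrier := {b | ∃ P : Weyl (PolyS r) n, b • powS F 0 = weylAct F P (powS F a)}
  add_mem' := by
    rintro b c ⟨P, hP⟩ ⟨Q, hQ⟩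
    exact ⟨P + Q, by rw [add_smul, hP, hQ, map_add, LinearMap.add_apply]⟩
  zero_mem' := ⟨0, by rw [zero_smul, map_zero, LinearMap.zero_apply]⟩
  smul_mem' := by
    rintro c b ⟨P, hP⟩
    exact ⟨c • P, by rw [smul_eq_mul, mul_smul, hP, map_smul, LinearMap.smul_apply]⟩

end Module

/-! ### Central hyperplane arrangements -/

section Arrangement

variable {n d : ℕ}

/-- The polynomial `∑_i l(e_i) x_i` of a linear form `l` on `ℂ^n`. -/
noncomputable def formPoly (l : Module.Dual ℂ (Fin n → ℂ)) : MvPolynomial (Fin n) ℂ :=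
  ∑ i, C (l (Pi.single i 1)) * X i

open Classical in
/-- The intersection lattice: all intersections of the hyperplanes `ker l_i`, `i ∈ I`,
with `I ⊆ {1, …, d}`. -/
noncomputable def edges (l : Fin d → Module.Dual ℂ (Fin n → ℂ)) :
    Finset (Submodule ℂ (Fin n → ℂ)) :=
  Finset.univ.image fun I : Finset (Fin d) => ⨅ i ∈ I, LinearMap.ker (l i)

open Classical in
/-- `J(X)`: the indices of all the forms that vanish on `X`. -/
noncomputable def indexSet (l : Fin d → Module.Dual ℂ (Fin n → ℂ))
    (X : Submodule ℂ (Fin n → ℂ)) : Finset (Fin d) :=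
  Finset.univ.filter fun j => X ≤ LinearMap.ker (l j)

/-- The rank of an edge, that is, its codimension. -/
noncomputable def rank (X : Submodule ℂ (Fin n → ℂ)) : ℕ :=
  Module.finrank ℂ ((Fin n → ℂ) ⧸ X)

/-- `X` is decomposable: for some linear coordinates `y_1, …, y_{r(X)}` of `ℂ^n / X ≅ ℂ^{r(X)}`
and some splitting of them into two nonempty sets, `f_X = ∏_{j ∈ J(X)} l_j` is the product of an
arrangement in the first set of variables and one in the second, i.e. each of its linear factors
involves only variables of one of the two sets. The linear forms on `ℂ^n / X` are the linear forms
on `ℂ^n` that vanish on `X`. -/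
def IsDecomposable (l : Fin d → Module.Dual ℂ (Fin n → ℂ)) (X : Submodule ℂ (Fin n → ℂ)) : Prop :=
  ∃ (y : Module.Basis (Fin (rank X)) ℂ X.dualAnnihilator) (T : Set (Fin (rank X))),
    T.Nonempty ∧ Tᶜ.Nonempty ∧ ∀ j ∈ indexSet l X,
      l j ∈ Submodule.span ℂ ((fun i => (y i : Module.Dual ℂ (Fin n → ℂ))) '' T) ∨
      l j ∈ Submodule.span ℂ ((fun i => (y i : Module.Dual ℂ (Fin n → ℂ))) '' Tᶜ)

open Classical in
/-- The indecomposable edges. The whole space `ℂ^n`, the empty intersection, with `f_X = 1`, does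
not count as one of them. -/
noncomputable def indecEdges (l : Fin d → Module.Dual ℂ (Fin n → ℂ)) :
    Finset (Submodule ℂ (Fin n → ℂ)) :=
  (edges l).filter fun X => X ≠ ⊤ ∧ ¬ IsDecomposable l X

end Arrangement

end BernsteinSato

/-!
For a set `J` of forms write `F_J^S = ∏_{k ∈ J} l_k^{s_k}`. All modules `ℂ[S][x, 1/f] F_J^S` are
realized on the same ring `ℂ[S][x, 1/f]`, with the operators `nablaDir l J v`; `genModule l J W u`
is the submodule generated by `u F_J^S` when only derivatives in the directions of `W` are used.

By induction over the edges, largest first, each edge `X` satisfies the functional equation of the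
subarrangement of the forms vanishing on `X`, with the factors of the indecomposable edges
containing `X`, and with operators differentiating only along any prescribed `W` with
`W + X = ℂ^n` (`exists_edgeProd_mem_genModule`). The centre of the arrangement gives the theorem.

* If `X` is decomposable, it is the transversal intersection of two larger edges `X₁`, `X₂`
  (`exists_edges_of_isDecomposable`). Operators along `W ∩ X₂` commute with the forms vanishing on
  `X₂`, and conversely, so the two functional equations can be multiplied
  (`scal_mul_mem_genModule_union`).
* If `X` is indecomposable, let `b` be the product of the factors of the strictly larger edges. Away
  from `X` the functional equation with `b` holds by induction: the forms on `X` that do not vanish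
  on a larger edge `Y` are units near the general point of `Y`, and conjugating by their powers
  costs only a denominator (`exists_pow_mul_mem_genModule`). Hence the ideal of all `p` for which `p b`
  lies in the module contains all products of `K` forms vanishing on `X`, for some `K`
  (`exists_prod_linForm_mem`). The Euler field transversal to `X` multiplies a product of `m` such
  forms times `F_J^S` by `∑_{j ∈ J(X)} s_j + m`; written as `∑ ∂_{v_i} y_i` it acts by
  `∑_{j ∈ J(X)} s_j + r(X) + m`, so these factors for `m < K` remove the product of forms
  (`mul_prod_edgeForm_mem_genModule`).
-/

namespace BernsteinSato

open MvPolynomial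

variable {n d : ℕ}

/-! ### Linear forms and directional derivatives -/

/-- A linear form `φ` on `ℂ^n`, viewed in `ℂ[S][x]`. -/
noncomputable def linForm (φ : Module.Dual ℂ (Fin n → ℂ)) : PolySX n d := toSX (formPoly φ)

theorem linForm_eq (φ : Module.Dual ℂ (Fin n → ℂ)) :
    (linForm φ : PolySX n d) = ∑ i, C (C (φ (Pi.single i 1))) * X i := by
  simp [linForm, toSX, formPoly]

theorem linForm_add (φ ψ : Module.Dual ℂ (Fin n → ℂ)) :
    (linForm (φ + ψ) : PolySX n d) = linForm φ + linForm ψ := by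
  simp [linForm_eq, add_mul, Finset.sum_add_distrib]

theorem linForm_smul (c : ℂ) (φ : Module.Dual ℂ (Fin n → ℂ)) :
    (linForm (c • φ) : PolySX n d) = C (C c) * linForm φ := by
  simp [linForm_eq, Finset.mul_sum, mul_assoc]

theorem linForm_zero : (linForm (0 : Module.Dual ℂ (Fin n → ℂ)) : PolySX n d) = 0 := by
  simp [linForm_eq]

theorem linForm_mem_of_mem_span (I : Ideal (PolySX n d)) {s : Set (Module.Dual ℂ (Fin n → ℂ))}
    (hs : ∀ φ ∈ s, linForm φ ∈ I) {φ : Module.Dual ℂ (Fin n → ℂ)}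
    (hφ : φ ∈ Submodule.span ℂ s) : linForm φ ∈ I := by
  induction hφ using Submodule.span_induction with
  | mem φ h => exact hs φ h
  | zero => rw [linForm_zero]; exact I.zero_mem
  | add φ ψ _ _ h₁ h₂ => rw [linForm_add]; exact I.add_mem h₁ h₂
  | smul c φ _ h => rw [linForm_smul]; exact I.mul_mem_left _ h

theorem dual_apply_eq_sum (φ : Module.Dual ℂ (Fin n → ℂ)) (v : Fin n → ℂ) :
    φ v = ∑ i, v i * φ (Pi.single i 1) := by
  conv_lhs => rw [pi_eq_sum_univ' v]
  simp [map_sum]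

variable (l : Fin d → Module.Dual ℂ (Fin n → ℂ))

/-- The ring `ℂ[S][x, 1/f]` of the arrangement `l`. -/
abbrev ArrRing : Type := LocRing fun j => formPoly (l j)

/-- The linear form `l_k` as an element of `ℂ[S][x, 1/f]`. -/
noncomputable abbrev arrElt (k : Fin d) : ArrRing l := elt (fun j => formPoly (l j)) k

theorem arrElt_eq (k : Fin d) : arrElt l k = algebraMap (PolySX n d) (ArrRing l) (linForm (l k)) :=
  rfl

/-- The scalars `ℂ[S]` inside `ℂ[S][x, 1/f]`. -/
noncomputable abbrev scal : PolyS d →+* ArrRing l := algebraMap (PolyS d) (ArrRing l)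

theorem scal_eq (b : PolyS d) : scal l b = algebraMap (PolySX n d) (ArrRing l) (C b) := by
  rw [scal, IsScalarTower.algebraMap_apply (PolyS d) (PolySX n d) (ArrRing l)]
  rfl

/-- The derivative of `ℂ[S][x, 1/f]` in the direction `v`. -/
noncomputable def dirD (v : Fin n → ℂ) : Derivation (PolyS d) (ArrRing l) (ArrRing l) :=
  ∑ i, (C (v i) : PolyS d) • partialD (fun j => formPoly (l j)) i

theorem dirD_apply (v : Fin n → ℂ) (u : ArrRing l) :
    dirD l v u = ∑ i, (C (v i) : PolyS d) • partialD (fun j => formPoly (l j)) i u := by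
  rw [dirD, ← Derivation.coeFnAddMonoidHom_apply, map_sum, Finset.sum_apply]
  rfl

theorem dirD_algebraMap (v : Fin n → ℂ) (p : PolySX n d) :
    ∃ q : PolySX n d, dirD l v (algebraMap _ _ p) = algebraMap _ _ q := by
  refine ⟨∑ i, (C (v i) : PolyS d) • pderiv i p, ?_⟩
  rw [dirD_apply, map_sum]
  refine Finset.sum_congr rfl fun i _ => ?_
  rw [partialD, locDer_algebraMap, algebraMap_smul_aux]

theorem dirD_linForm (v : Fin n → ℂ) (φ : Module.Dual ℂ (Fin n → ℂ)) :
    dirD l v (algebraMap (PolySX n d) _ (linForm φ)) = scal l (C (φ v)) := by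
  rw [dirD_apply, dual_apply_eq_sum φ v, map_sum, map_sum]
  refine Finset.sum_congr rfl fun i _ => ?_
  have h : pderiv i (linForm φ : PolySX n d) = C (C (φ (Pi.single i 1))) := by
    classical
    simp [linForm_eq, Derivation.leibniz, pderiv_X, Pi.single_apply]
  rw [partialD, locDer_algebraMap, h, ← scal_eq, Algebra.smul_def, ← map_mul, ← map_mul]

theorem dirD_arrElt (v : Fin n → ℂ) (k : Fin d) :
    dirD l v (arrElt l k) = scal l (C (l k v)) := dirD_linForm l v (l k)

theorem arrElt_mul_inverse (k : Fin d) : arrElt l k * Ring.inverse (arrElt l k) = 1 :=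
  Ring.mul_inverse_cancel _ (elt_isUnit _ k)

/-! ### Modules of subarrangements -/

/-- The logarithmic derivative of `∏_{k ∈ J} l_k^{s_k}` in the direction `v`. -/
noncomputable def logDir (J : Finset (Fin d)) (v : Fin n → ℂ) : ArrRing l :=
  ∑ k ∈ J, scal l (X k) * (dirD l v (arrElt l k) * Ring.inverse (arrElt l k))

/-- The action of `∂_v` on `u ∏_{k ∈ J} l_k^{s_k}`, written on the coefficient `u`. -/
noncomputable def nablaDir (J : Finset (Fin d)) (v : Fin n → ℂ) (u : ArrRing l) : ArrRing l :=
  dirD l v u + logDir l J v * u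

/-- The elements of `ℂ[S][x, 1/f]` obtained from `u` by sums, multiplication by `ℂ[S][x]` and the
operators `nablaDir l J w`, `w ∈ W`. -/
inductive Gen (J : Finset (Fin d)) (W : Submodule ℂ (Fin n → ℂ)) (u : ArrRing l) :
    ArrRing l → Prop
  | base : Gen J W u u
  | add {x y : ArrRing l} : Gen J W u x → Gen J W u y → Gen J W u (x + y)
  | mul (p : PolySX n d) {x : ArrRing l} : Gen J W u x → Gen J W u (algebraMap _ _ p * x)
  | nabla {w : Fin n → ℂ} (hw : w ∈ W) {x : ArrRing l} : Gen J W u x →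
      Gen J W u (nablaDir l J w x)

/-- The `ℂ[S][x]`-module of coefficients of the submodule generated by `u ∏_{k ∈ J} l_k^{s_k}`
under the differential operators that differentiate only in the directions of `W`. -/
noncomputable def genModule (J : Finset (Fin d)) (W : Submodule ℂ (Fin n → ℂ)) (u : ArrRing l) :
    Submodule (PolySX n d) (ArrRing l) where
  carrier := {x | Gen l J W u x}
  add_mem' := Gen.add
  zero_mem' := by
    have h := Gen.mul 0 (Gen.base (l := l) (J := J) (W := W) (u := u))
    rwa [map_zero, zero_mul] at h
  smul_mem' p x hx := by
    rw [Algebra.smul_def]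
    exact Gen.mul p hx

variable {l} {J : Finset (Fin d)} {W : Submodule ℂ (Fin n → ℂ)} {u : ArrRing l}

theorem mul_mem_genModule (p : PolySX n d) {x : ArrRing l} (hx : x ∈ genModule l J W u) :
    algebraMap _ _ p * x ∈ genModule l J W u := Gen.mul p hx

theorem scal_mul_mem_genModule (b : PolyS d) {x : ArrRing l} (hx : x ∈ genModule l J W u) :
    scal l b * x ∈ genModule l J W u := by
  rw [scal_eq]
  exact mul_mem_genModule _ hx

theorem nabla_mem_genModule {w : Fin n → ℂ} (hw : w ∈ W) {x : ArrRing l}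
    (hx : x ∈ genModule l J W u) : nablaDir l J w x ∈ genModule l J W u := Gen.nabla hw hx

variable (l)

theorem nablaDir_univ (v : Fin n → ℂ) (x : ArrRing l) :
    nablaDir l Finset.univ v x =
      ∑ i, (C (v i) : PolyS d) • nabla (fun j => formPoly (l j)) i x := by
  simp only [nabla_apply, smul_add, Finset.sum_add_distrib, ← dirD_apply]
  rw [nablaDir, logDir]
  congr 1
  simp only [dirD_apply, logD, Finset.sum_mul, Finset.mul_sum, Finset.smul_sum]
  rw [Finset.sum_comm]
  refine Finset.sum_congr rfl fun i _ => Finset.sum_congr rfl fun k _ => ?_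
  simp only [Algebra.smul_def]
  ring

/-- For the full arrangement and all directions, `genModule` consists of the images under the Weyl
algebra over `ℂ[S]`. -/
theorem exists_weylAct_of_mem_genModule {x : ArrRing l}
    (hx : x ∈ genModule l Finset.univ W u) :
    ∃ P : Weyl (PolyS d) n, x = weylAct (fun j => formPoly (l j)) P u := by
  have hX (i : Fin n) (y : ArrRing l) :
      weylAct (fun j => formPoly (l j))
        (RingQuot.mkAlgHom (PolyS d) _ (FreeAlgebra.ι _ (Sum.inl i))) y =
        algebraMap (PolySX n d) _ (X i) * y := by
    simp [weylAct, mulX_apply]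
  have hD (i : Fin n) (y : ArrRing l) :
      weylAct (fun j => formPoly (l j))
        (RingQuot.mkAlgHom (PolyS d) _ (FreeAlgebra.ι _ (Sum.inr i))) y =
        nabla (fun j => formPoly (l j)) i y := by
    simp [weylAct]
  induction hx with
  | base => exact ⟨1, by simp⟩
  | add _ _ h₁ h₂ =>
    obtain ⟨P, rfl⟩ := h₁
    obtain ⟨Q, rfl⟩ := h₂
    exact ⟨P + Q, by simp⟩
  | mul p _ h =>
    obtain ⟨P, rfl⟩ := h
    induction p using MvPolynomial.induction_on with
    | C c => exact ⟨c • P, by rw [← scal_eq, map_smul, LinearMap.smul_apply, Algebra.smul_def]⟩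
    | add p q hp hq =>
      obtain ⟨P₁, h₁⟩ := hp
      obtain ⟨P₂, h₂⟩ := hq
      exact ⟨P₁ + P₂, by rw [map_add, map_add, LinearMap.add_apply, add_mul, h₁, h₂]⟩
    | mul_X p i hp =>
      obtain ⟨P₁, h₁⟩ := hp
      refine ⟨RingQuot.mkAlgHom (PolyS d) _ (FreeAlgebra.ι _ (Sum.inl i)) * P₁, ?_⟩
      rw [map_mul (weylAct _), Module.End.mul_apply, hX, ← h₁, map_mul]
      ring
  | @nabla w _ _ _ h =>
    obtain ⟨P, rfl⟩ := h
    refine ⟨∑ i, (C (w i) : PolyS d) •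
      (RingQuot.mkAlgHom (PolyS d) _ (FreeAlgebra.ι _ (Sum.inr i)) * P), ?_⟩
    simp only [nablaDir_univ, map_sum, map_smul, map_mul, LinearMap.sum_apply,
      LinearMap.smul_apply, Module.End.mul_apply, hD]

variable {l}

theorem logDir_union {J₁ J₂ : Finset (Fin d)} (h : Disjoint J₁ J₂) (v : Fin n → ℂ) :
    logDir l (J₁ ∪ J₂) v = logDir l J₁ v + logDir l J₂ v :=
  Finset.sum_union h

theorem logDir_eq_zero {v : Fin n → ℂ} (h : ∀ k ∈ J, l k v = 0) : logDir l J v = 0 :=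
  Finset.sum_eq_zero fun k hk => by simp [dirD_arrElt, h k hk]

theorem dirD_prod_eq_zero {v : Fin n → ℂ} (a : Fin d → ℕ) (h : ∀ k ∈ J, l k v = 0) :
    dirD l v (∏ k ∈ J, arrElt l k ^ a k) = 0 := by
  induction J using Finset.cons_induction with
  | empty => simp
  | cons k J hk ih =>
    rw [Finset.prod_cons, Derivation.leibniz, ih fun k hk => h k (Finset.mem_cons_of_mem hk),
      Derivation.leibniz_pow, dirD_arrElt, h k (Finset.mem_cons_self k J)]
    simp

/-- Multiplication by an element annihilated by the operators for `J'` in the directions of `W'`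
carries modules for `J` to modules for `J ∪ J'`. -/
theorem mul_mem_genModule_union {J' : Finset (Fin d)} {W' : Submodule ℂ (Fin n → ℂ)}
    {x y : ArrRing l} {t : ArrRing l} (hJ : Disjoint J J') (hW : W' ≤ W)
    (hy : ∀ w ∈ W', dirD l w y = 0) (hJ' : ∀ w ∈ W', ∀ k ∈ J', l k w = 0)
    (hu : y * u ∈ genModule l (J ∪ J') W t) (hx : x ∈ genModule l J W' u) :
    y * x ∈ genModule l (J ∪ J') W t := by
  induction hx with
  | base => exact hu
  | add _ _ h₁ h₂ => rw [mul_add]; exact add_mem h₁ h₂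
  | mul p _ h => rw [mul_left_comm]; exact mul_mem_genModule p h
  | @nabla w hw x _ h =>
    convert nabla_mem_genModule (hW hw) h using 1
    rw [nablaDir, nablaDir, logDir_union hJ, logDir_eq_zero (hJ' w hw), Derivation.leibniz,
      hy w hw, smul_eq_mul, smul_zero]
    ring

/-- If `J = J₁ ∪ J₂`, the operators for `W₁` do not see the forms in `J₂` and vice versa, then
functional equations for `J₁` and `J₂` multiply to one for `J`. -/
theorem scal_mul_mem_genModule_union {J₁ J₂ : Finset (Fin d)} {W₁ W₂ : Submodule ℂ (Fin n → ℂ)}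
    (a : Fin d → ℕ) (hJ : Disjoint J₁ J₂) (hW₁ : W₁ ≤ W) (hW₂ : W₂ ≤ W)
    (h₁ : ∀ w ∈ W₁, ∀ k ∈ J₂, l k w = 0) (h₂ : ∀ w ∈ W₂, ∀ k ∈ J₁, l k w = 0) {b₁ b₂ : PolyS d}
    (hb₁ : scal l b₁ ∈ genModule l J₁ W₁ (∏ k ∈ J₁, arrElt l k ^ a k))
    (hb₂ : scal l b₂ ∈ genModule l J₂ W₂ (∏ k ∈ J₂, arrElt l k ^ a k)) :
    scal l (b₁ * b₂) ∈ genModule l (J₁ ∪ J₂) W (∏ k ∈ J₁ ∪ J₂, arrElt l k ^ a k) := by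
  have e₁ : (∏ k ∈ J₂, arrElt l k ^ a k) * scal l b₁ ∈
      genModule l (J₁ ∪ J₂) W (∏ k ∈ J₁ ∪ J₂, arrElt l k ^ a k) := by
    refine mul_mem_genModule_union hJ hW₁ (fun w hw => dirD_prod_eq_zero a (h₁ w hw)) h₁ ?_ hb₁
    rw [mul_comm, ← Finset.prod_union hJ]
    exact Gen.base
  rw [map_mul]
  rw [Finset.union_comm] at e₁ ⊢
  refine mul_mem_genModule_union hJ.symm hW₂ (fun w _ => ?_) h₂ ?_ hb₂
  · exact Derivation.map_algebraMap _ _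
  · rwa [mul_comm]

/-- Functional equations for a subarrangement `J'` hold for `J` up to a power of the product of the
remaining forms. -/
theorem exists_pow_mul_mem_genModule {J' : Finset (Fin d)} (a : Fin d → ℕ) (hJ : J' ⊆ J)
    {x : ArrRing l} (hx : x ∈ genModule l J' W (∏ k ∈ J', arrElt l k ^ a k)) :
    ∃ M : ℕ, algebraMap (PolySX n d) (ArrRing l) ((∏ k ∈ J \ J', linForm (l k)) ^ M) * x ∈
      genModule l J W (∏ k ∈ J, arrElt l k ^ a k) := by
  set g : PolySX n d := ∏ k ∈ J \ J', linForm (l k) with hg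
  have hmono {x : ArrRing l} {M M' : ℕ} (h : M ≤ M')
      (hM : algebraMap _ _ (g ^ M) * x ∈ genModule l J W (∏ k ∈ J, arrElt l k ^ a k)) :
      algebraMap _ _ (g ^ M') * x ∈ genModule l J W (∏ k ∈ J, arrElt l k ^ a k) := by
    rw [← Nat.sub_add_cancel h, pow_add, map_mul, mul_assoc]
    exact mul_mem_genModule _ hM
  induction hx with
  | base =>
    refine ⟨∑ k, a k, ?_⟩
    have h : (∏ k ∈ J \ J', linForm (l k) ^ a k : PolySX n d) ∣ g ^ ∑ k, a k := by
      rw [hg, ← Finset.prod_pow]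
      exact Finset.prod_dvd_prod_of_dvd _ _ fun k _ =>
        pow_dvd_pow _ (Finset.single_le_sum (fun _ _ => Nat.zero_le _) (Finset.mem_univ k))
    obtain ⟨q, hq⟩ := h
    rw [hq, mul_comm _ q, map_mul, map_prod, mul_assoc]
    simp only [map_pow, ← arrElt_eq]
    rw [Finset.prod_sdiff hJ]
    exact mul_mem_genModule _ Gen.base
  | add _ _ h₁ h₂ =>
    obtain ⟨M₁, h₁⟩ := h₁
    obtain ⟨M₂, h₂⟩ := h₂
    refine ⟨max M₁ M₂, ?_⟩
    rw [mul_add]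
    exact add_mem (hmono (le_max_left _ _) h₁) (hmono (le_max_right _ _) h₂)
  | mul p _ h =>
    obtain ⟨M, h⟩ := h
    refine ⟨M, ?_⟩
    rw [mul_left_comm]
    exact mul_mem_genModule p h
  | @nabla w hw x _ h =>
    obtain ⟨M, h⟩ := h
    refine ⟨M + 1, ?_⟩
    obtain ⟨q', hq'⟩ := dirD_algebraMap l w g
    -- the logarithmic derivative of the remaining factors has denominator `g`
    have hlog : ∃ p : PolySX n d, algebraMap _ _ g * logDir l (J \ J') w = algebraMap _ _ p := by
      refine ⟨∑ k ∈ J \ J', C (X k) * (C (C (l k w)) *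
        ∏ j ∈ (J \ J').erase k, linForm (l j)), ?_⟩
      rw [logDir, Finset.mul_sum, map_sum]
      refine Finset.sum_congr rfl fun k hk => ?_
      rw [hg, ← Finset.mul_prod_erase _ _ hk, dirD_arrElt, scal_eq, scal_eq]
      simp only [map_mul]
      rw [← arrElt_eq]
      linear_combination
        algebraMap (PolySX n d) (ArrRing l) (∏ j ∈ (J \ J').erase k, linForm (l j)) *
        algebraMap (PolySX n d) _ (C (X k)) * algebraMap (PolySX n d) _ (C (C (l k w))) *
        arrElt_mul_inverse l k
    obtain ⟨p, hp⟩ := hlog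
    have hJe : logDir l J w = logDir l (J \ J') w + logDir l J' w := by
      rw [← logDir_union Finset.sdiff_disjoint, Finset.sdiff_union_of_subset hJ]
    have key : algebraMap _ _ (g ^ (M + 1)) * nablaDir l J' w x =
        nablaDir l J w (algebraMap _ _ g * (algebraMap _ _ (g ^ M) * x)) -
          algebraMap _ _ ((M + 1 : ℕ) * q' + p) * (algebraMap _ _ (g ^ M) * x) := by
      rw [← mul_assoc, ← map_mul, ← pow_succ', nablaDir, nablaDir, hJe, Derivation.leibniz]
      simp only [map_pow, Derivation.leibniz_pow, hq', map_add, map_mul, map_natCast, smul_eq_mul,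
        nsmul_eq_mul, ← hp, Nat.add_sub_cancel]
      ring
    rw [key]
    exact sub_mem (nabla_mem_genModule hw (mul_mem_genModule _ h)) (mul_mem_genModule _ h)

/-! ### Edges -/

theorem mem_indexSet {X : Submodule ℂ (Fin n → ℂ)} {j : Fin d} :
    j ∈ indexSet l X ↔ X ≤ LinearMap.ker (l j) := by
  simp [indexSet]

theorem indexSet_anti {X Y : Submodule ℂ (Fin n → ℂ)} (h : X ≤ Y) :
    indexSet l Y ⊆ indexSet l X := fun _ hj =>
  mem_indexSet.2 (h.trans (mem_indexSet.1 hj))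

variable (l) in
theorem iInf_ker_mem_edges (K : Finset (Fin d)) : ⨅ k ∈ K, LinearMap.ker (l k) ∈ edges l :=
  Finset.mem_image_of_mem _ (Finset.mem_univ K)

theorem iInf_indexSet_of_mem_edges {X : Submodule ℂ (Fin n → ℂ)} (hX : X ∈ edges l) :
    ⨅ k ∈ indexSet l X, LinearMap.ker (l k) = X := by
  obtain ⟨I, -, rfl⟩ := Finset.mem_image.1 hX
  refine le_antisymm (le_iInf₂ fun i hi => ?_) (le_iInf₂ fun k hk => mem_indexSet.1 hk)
  exact iInf₂_le i (mem_indexSet.2 (iInf₂_le i hi))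

theorem mem_span_of_mem_indexSet {K : Finset (Fin d)} {j : Fin d}
    (hj : j ∈ indexSet l (⨅ k ∈ K, LinearMap.ker (l k))) :
    l j ∈ Submodule.span ℂ (l '' K) := by
  have h : ⨅ k : K, LinearMap.ker (l k) ≤ LinearMap.ker (l j) := by
    rw [iInf_subtype]
    exact mem_indexSet.1 hj
  have := mem_span_of_iInf_ker_le_ker h
  rwa [Set.range_comp' l, Subtype.range_coe_subtype] at this

/-- Vectors dual to a basis of the forms vanishing on `X` can be chosen in any subspace that
together with `X` spans the whole space. -/
theorem exists_dual_vectors {X W : Submodule ℂ (Fin n → ℂ)} (hW : W ⊔ X = ⊤) {ι : Type*}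
    (y : Module.Basis ι ℂ X.dualAnnihilator) :
    ∃ v : ι → Fin n → ℂ, (∀ i, v i ∈ W) ∧
      ∀ (φ : X.dualAnnihilator) (i : ι), φ.1 (v i) = y.repr φ i := by
  have h (i : ι) : ∃ w ∈ W, ∀ φ : X.dualAnnihilator, φ.1 w = y.repr φ i := by
    obtain ⟨q, hq⟩ :=
      (Subspace.quotDualCoannihilatorToDual_bijective X.dualAnnihilator).2 (y.coord i)
    obtain ⟨v, rfl⟩ := Submodule.Quotient.mk_surjective _ q
    obtain ⟨w, hw, x, hx, rfl⟩ := Submodule.mem_sup.1 (hW ▸ Submodule.mem_top : v ∈ W ⊔ X)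
    refine ⟨w, hw, fun φ => ?_⟩
    have e := LinearMap.congr_fun hq φ
    rw [Submodule.quotDualCoannihilatorToDual_apply, map_add,
      (Submodule.mem_dualAnnihilator φ.1).1 φ.2 x hx, add_zero] at e
    exact e
  choose v hv hv' using h
  exact ⟨v, hv, fun φ i => hv' i φ⟩

theorem rank_eq_finrank_dualAnnihilator (X : Submodule ℂ (Fin n → ℂ)) :
    rank X = Module.finrank ℂ X.dualAnnihilator :=
  (Subspace.quotEquivAnnihilator X).finrank_eq

/-- A decomposable edge is the transversal intersection of two larger edges whose forms together
are the forms of the given edge. -/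
theorem exists_edges_of_isDecomposable {X : Submodule ℂ (Fin n → ℂ)} (hX : X ∈ edges l)
    (h : IsDecomposable l X) :
    ∃ X₁ ∈ edges l, ∃ X₂ ∈ edges l, X < X₁ ∧ X < X₂ ∧ X₁ ⊓ X₂ = X ∧ X₁ ⊔ X₂ = ⊤ ∧
      indexSet l X₁ ∪ indexSet l X₂ = indexSet l X := by
  classical
  obtain ⟨y, T, ⟨i₁, hi₁⟩, ⟨i₂, hi₂⟩, hT⟩ := h
  obtain ⟨v, -, hv⟩ := exists_dual_vectors (top_sup_eq X) y
  let A (T : Set (Fin (rank X))) : Submodule ℂ (Module.Dual ℂ (Fin n → ℂ)) :=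
    Submodule.span ℂ ((fun i => (y i : Module.Dual ℂ (Fin n → ℂ))) '' T)
  let Z (T : Set (Fin (rank X))) : Submodule ℂ (Fin n → ℂ) :=
    ⨅ k ∈ (indexSet l X).filter fun j => l j ∈ A T, LinearMap.ker (l k)
  have hZ {T : Set (Fin (rank X))} {w : Fin n → ℂ} (hw : ∀ i ∈ T, (y i).1 w = 0) : w ∈ Z T := by
    simp only [Z, Submodule.mem_iInf, Finset.mem_filter, LinearMap.mem_ker]
    rintro k ⟨-, hk⟩
    have : A T ≤ LinearMap.ker (Module.Dual.eval ℂ (Fin n → ℂ) w) := by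
      refine Submodule.span_le.2 ?_
      rintro _ ⟨i, hi, rfl⟩
      exact hw i hi
    exact this hk
  have hyv (i j : Fin (rank X)) : (y i).1 (v j) = if i = j then 1 else 0 := by
    rw [hv, Module.Basis.repr_self, Finsupp.single_apply]
  have hXZ (T : Set (Fin (rank X))) {i : Fin (rank X)} (hi : i ∉ T) : X < Z T := by
    refine lt_of_le_of_ne (le_iInf₂ fun k hk =>
      mem_indexSet.1 (Finset.mem_filter.1 hk).1) fun he => ?_
    have h₁ : v i ∈ X := he ▸ hZ fun j hj => by
      rw [hyv, if_neg]
      rintro rfl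
      exact hi hj
    have h₂ := (Submodule.mem_dualAnnihilator _).1 (y i).2 _ h₁
    rw [hyv, if_pos rfl] at h₂
    exact one_ne_zero h₂
  have hsub : indexSet l X ⊆ indexSet l (Z T) ∪ indexSet l (Z Tᶜ) := by
    intro j hj
    rw [Finset.mem_union]
    exact (hT j hj).imp
      (fun h => mem_indexSet.2 (iInf₂_le j (Finset.mem_filter.2 ⟨hj, h⟩)))
      (fun h => mem_indexSet.2 (iInf₂_le j (Finset.mem_filter.2 ⟨hj, h⟩)))
  refine ⟨Z T, iInf_ker_mem_edges l _, Z Tᶜ, iInf_ker_mem_edges l _, hXZ T hi₂,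
    hXZ Tᶜ (not_not.2 hi₁), ?_, ?_, ?_⟩
  · refine le_antisymm ?_ (le_inf (hXZ T hi₂).le (hXZ Tᶜ (not_not.2 hi₁)).le)
    conv_rhs => rw [← iInf_indexSet_of_mem_edges hX]
    refine le_iInf₂ fun j hj => ?_
    rcases Finset.mem_union.1 (hsub hj) with h | h
    · exact inf_le_left.trans (mem_indexSet.1 h)
    · exact inf_le_right.trans (mem_indexSet.1 h)
  · refine eq_top_iff.2 fun w _ => ?_
    -- remove from `w` its components along the vectors dual to the coordinates in `T`
    let t : Fin n → ℂ := ∑ i with i ∈ T, (y i).1 w • v i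
    have ht (i : Fin (rank X)) : (y i).1 t = if i ∈ T then (y i).1 w else 0 := by
      simp [t, hyv, Finset.sum_ite_eq]
    refine Submodule.mem_sup.2 ⟨w - t, hZ fun i hi => ?_, t, hZ fun i hi => ?_, sub_add_cancel w t⟩
    · rw [map_sub, ht, if_pos hi, sub_self]
    · rw [ht, if_neg hi]
  · exact (Finset.union_subset (indexSet_anti (hXZ T hi₂).le)
      (indexSet_anti (hXZ Tᶜ (not_not.2 hi₁)).le)).antisymm hsub

/-! ### The Euler field transversal to an edge -/

/-- `∑ y_i ∂_{v_i}` is the Euler field: it fixes the forms vanishing on `X`. -/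
theorem sum_linForm_mul {X : Submodule ℂ (Fin n → ℂ)} {ι : Type*} [Fintype ι]
    (y : Module.Basis ι ℂ X.dualAnnihilator) {v : ι → Fin n → ℂ}
    (hv : ∀ (φ : X.dualAnnihilator) (i : ι), φ.1 (v i) = y.repr φ i)
    {φ : Module.Dual ℂ (Fin n → ℂ)} (hφ : φ ∈ X.dualAnnihilator) :
    ∑ i, algebraMap (PolySX n d) (ArrRing l) (linForm (y i).1) *
      dirD l (v i) (algebraMap (PolySX n d) _ (linForm φ)) =
        algebraMap (PolySX n d) _ (linForm φ) := by
  have h : φ = ∑ i, φ (v i) • (y i).1 := by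
    have := congrArg Subtype.val (y.sum_repr ⟨φ, hφ⟩)
    rw [Submodule.coe_sum] at this
    simpa [← hv] using this.symm
  have hlin : (linForm φ : PolySX n d) = ∑ i, C (C (φ (v i))) * linForm (y i).1 := by
    let L : Module.Dual ℂ (Fin n → ℂ) →+ PolySX n d := ⟨⟨linForm, linForm_zero⟩, linForm_add⟩
    conv_lhs => rw [h]
    change L _ = _
    rw [map_sum]
    exact Finset.sum_congr rfl fun i _ => linForm_smul _ _
  simp only [dirD_linForm, scal_eq, ← map_mul, ← map_sum]
  rw [hlin]
  simp only [mul_comm]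

/-- The linear form `∑_{j ∈ J(X)} s_j + r(X) + m` attached to an edge. -/
noncomputable def edgeForm (l : Fin d → Module.Dual ℂ (Fin n → ℂ)) (X : Submodule ℂ (Fin n → ℂ))
    (m : ℕ) : PolyS d :=
  (∑ j ∈ indexSet l X, MvPolynomial.X j) + C (rank X : ℂ) + C (m : ℂ)

/-- Euler's formula for a product `h` of `m` forms vanishing on `X`: the operators
`∂_{v_i} y_i` sum up to multiplication by `∑_{j ∈ J(X)} s_j + r(X) + m`. -/
theorem edgeForm_mul_mem_genModule {X W : Submodule ℂ (Fin n → ℂ)} (hW : W ⊔ X = ⊤)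
    {u : ArrRing l} {b : PolyS d} {L : List (Module.Dual ℂ (Fin n → ℂ))}
    (hL : ∀ φ ∈ L, φ ∈ X.dualAnnihilator)
    (h : ∀ φ ∈ X.dualAnnihilator, algebraMap (PolySX n d) (ArrRing l)
      (linForm φ * (L.map linForm).prod) * scal l b ∈ genModule l (indexSet l X) W u) :
    algebraMap (PolySX n d) (ArrRing l) (L.map linForm).prod * scal l (b * edgeForm l X L.length) ∈
      genModule l (indexSet l X) W u := by
  let y := Module.finBasisOfFinrankEq ℂ X.dualAnnihilator (rank_eq_finrank_dualAnnihilator X).symm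
  obtain ⟨v, hvW, hv⟩ := exists_dual_vectors hW y
  set a := algebraMap (PolySX n d) (ArrRing l) with ha
  have hdeg : ∑ i, a (linForm (y i).1) * dirD l (v i) (a (L.map linForm).prod) =
      (L.length : ArrRing l) * a (L.map linForm).prod := by
    clear h
    induction L with
    | nil => simp
    | cons φ L ih =>
      have h₁ := ih fun ψ hψ => hL ψ (List.mem_cons_of_mem φ hψ)
      have h₂ := sum_linForm_mul (d := d) (l := l) y hv (hL φ List.mem_cons_self)
      simp only [List.map_cons, List.prod_cons, map_mul, Derivation.leibniz, smul_eq_mul, mul_add,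
        Finset.sum_add_distrib, List.length_cons, Nat.cast_succ]
      simp only [mul_left_comm (a (linForm (y _).1)), ← Finset.mul_sum]
      rw [← ha] at h₂
      rw [h₁, h₂]
      ring
  have hlog : ∑ i, a (linForm (y i).1) * logDir l (indexSet l X) (v i) =
      scal l (∑ j ∈ indexSet l X, MvPolynomial.X j) := by
    simp only [logDir, Finset.mul_sum, map_sum]
    rw [Finset.sum_comm]
    refine Finset.sum_congr rfl fun k hk => ?_
    have h₂ := sum_linForm_mul (d := d) (l := l) y hv (φ := l k)
      ((Submodule.mem_dualAnnihilator _).2 fun w hw => mem_indexSet.1 hk hw)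
    rw [← arrElt_eq] at h₂
    calc _ = scal l (MvPolynomial.X k) * ((∑ i, a (linForm (y i).1) * dirD l (v i) (arrElt l k)) *
          Ring.inverse (arrElt l k)) := by
          rw [Finset.sum_mul, Finset.mul_sum]
          exact Finset.sum_congr rfl fun i _ => by ring
      _ = _ := by rw [h₂, arrElt_mul_inverse, mul_one]
  have hone (i) : dirD l (v i) (a (linForm (y i).1)) = 1 := by
    rw [dirD_linForm, hv, Module.Basis.repr_self, Finsupp.single_eq_same, C_1, map_one]
  have key : a (L.map linForm).prod * scal l (b * edgeForm l X L.length) =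
      ∑ i, nablaDir l (indexSet l X) (v i)
        (a (linForm (y i).1 * (L.map linForm).prod) * scal l b) := by
    have hi (i) : nablaDir l (indexSet l X) (v i)
        (a (linForm (y i).1 * (L.map linForm).prod) * scal l b) =
        scal l b * a (L.map linForm).prod +
        scal l b * (a (linForm (y i).1) * dirD l (v i) (a (L.map linForm).prod)) +
        scal l b * a (L.map linForm).prod *
          (a (linForm (y i).1) * logDir l (indexSet l X) (v i)) := by
      rw [nablaDir, Derivation.leibniz, Derivation.map_algebraMap, map_mul, Derivation.leibniz,
        hone]
      simp only [smul_eq_mul]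
      ring
    simp only [hi, Finset.sum_add_distrib, ← Finset.mul_sum, hdeg, hlog]
    simp only [edgeForm, map_mul, map_add, Finset.sum_const, Finset.card_univ, Fintype.card_fin,
      nsmul_eq_mul, map_natCast]
    ring
  rw [key]
  exact sum_mem fun i _ => nabla_mem_genModule (hvW i) (h _ (y i).2)

/-- Applying Euler's formula `K` times removes all products of `K` forms vanishing on `X`. -/
theorem mul_prod_edgeForm_mem_genModule {X W : Submodule ℂ (Fin n → ℂ)} (hW : W ⊔ X = ⊤)
    {u : ArrRing l} (K : ℕ) {b : PolyS d}
    (h : ∀ L : List (Module.Dual ℂ (Fin n → ℂ)), (∀ φ ∈ L, φ ∈ X.dualAnnihilator) →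
      L.length = K → algebraMap (PolySX n d) (ArrRing l) (L.map linForm).prod * scal l b ∈
        genModule l (indexSet l X) W u) :
    scal l (b * ∏ m ∈ Finset.range K, edgeForm l X m) ∈ genModule l (indexSet l X) W u := by
  induction K generalizing b with
  | zero => simpa using h [] (by simp) rfl
  | succ K ih =>
    rw [Finset.prod_range_succ, mul_comm _ (edgeForm l X K), ← mul_assoc]
    refine ih fun L hL hK => ?_
    rw [← hK]
    refine edgeForm_mul_mem_genModule hW hL fun φ hφ => ?_
    simpa using h (φ :: L) (List.forall_mem_cons.2 ⟨hφ, hL⟩) (by simp [hK])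

/-! ### Induction over the edges -/

open Classical in
/-- The product over the indecomposable edges containing `X` of the first `N + 1` linear forms
attached to them. -/
noncomputable def edgeProd (l : Fin d → Module.Dual ℂ (Fin n → ℂ)) (X : Submodule ℂ (Fin n → ℂ))
    (N : ℕ) : PolyS d :=
  ∏ Y ∈ (indecEdges l).filter (X ≤ ·), ∏ m ∈ Finset.range (N + 1), edgeForm l Y m

theorem prod_edgeForm_dvd (X : Submodule ℂ (Fin n → ℂ)) {K N : ℕ} (h : K ≤ N) :
    ∏ m ∈ Finset.range K, edgeForm l X m ∣ ∏ m ∈ Finset.range N, edgeForm l X m :=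
  Finset.prod_dvd_prod_of_subset _ _ _ (Finset.range_subset_range.2 h)

theorem edgeProd_dvd {X Y : Submodule ℂ (Fin n → ℂ)} (h : X ≤ Y) {M N : ℕ} (hMN : M ≤ N) :
    edgeProd l Y M ∣ edgeProd l X N := by
  classical
  refine (Finset.prod_dvd_prod_of_dvd _ _ fun Z _ =>
    prod_edgeForm_dvd Z (Nat.succ_le_succ hMN)).trans (Finset.prod_dvd_prod_of_subset _ _ _ ?_)
  exact Finset.monotone_filter_right _ fun Z _ hZ => h.trans hZ

theorem scal_mem_of_dvd {J : Finset (Fin d)} {W : Submodule ℂ (Fin n → ℂ)} {u : ArrRing l}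
    {b c : PolyS d} (h : b ∣ c) (hb : scal l b ∈ genModule l J W u) :
    scal l c ∈ genModule l J W u := by
  obtain ⟨e, rfl⟩ := h
  rw [mul_comm, map_mul]
  exact scal_mul_mem_genModule e hb

theorem edgeProd_mul_dvd {X X₁ X₂ : Submodule ℂ (Fin n → ℂ)} (h₁ : X ≤ X₁) (h₂ : X ≤ X₂)
    (h : X₁ ⊔ X₂ = ⊤) (N : ℕ) : edgeProd l X₁ N * edgeProd l X₂ N ∣ edgeProd l X N := by
  classical
  rw [edgeProd, edgeProd, ← Finset.prod_union]
  · refine Finset.prod_dvd_prod_of_subset _ _ _ fun Y hY => ?_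
    rw [Finset.mem_union, Finset.mem_filter, Finset.mem_filter] at hY
    rw [Finset.mem_filter]
    exact hY.elim (fun h => ⟨h.1, h₁.trans h.2⟩) (fun h => ⟨h.1, h₂.trans h.2⟩)
  · refine Finset.disjoint_left.2 fun Y hY₁ hY₂ => ?_
    rw [Finset.mem_filter] at hY₁ hY₂
    exact (Finset.mem_filter.1 hY₁.1).2.1 (top_le_iff.1 (h ▸ sup_le hY₁.2 hY₂.2))

/-- If an ideal contains, for every edge `Y` strictly larger than `X`, a power of the product of
the forms vanishing on `X` and not on `Y`, then its zero set lies in `X`. Since the forms are linear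
this follows for each prime over the ideal, without the Nullstellensatz. -/
theorem linForm_mem_radical {X : Submodule ℂ (Fin n → ℂ)} (I : Ideal (PolySX n d))
    (hI : ∀ Y ∈ edges l, X < Y →
      ∃ M : ℕ, (∏ k ∈ indexSet l X \ indexSet l Y, linForm (l k)) ^ M ∈ I)
    {j : Fin d} (hj : j ∈ indexSet l X) : linForm (l j) ∈ I.radical := by
  classical
  rw [Ideal.radical_eq_sInf]
  refine Ideal.mem_sInf.2 ?_
  rintro Q ⟨hIQ, hQ⟩
  by_contra hjQ
  -- the edge cut out by those forms on `X` which vanish on the zero set of `Q`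
  set K := (indexSet l X).filter fun k => linForm (l k) ∈ Q with hK
  set Y := ⨅ k ∈ K, LinearMap.ker (l k) with hY
  have hXY : X ≤ Y := le_iInf₂ fun k hk => mem_indexSet.1 (Finset.mem_filter.1 hk).1
  have hYQ {i : Fin d} (hi : i ∈ indexSet l Y) : linForm (l i) ∈ Q := by
    refine linForm_mem_of_mem_span Q ?_ (mem_span_of_mem_indexSet hi)
    rintro _ ⟨k, hk, rfl⟩
    exact (Finset.mem_filter.1 hk).2
  have hne : X ≠ Y := fun h => hjQ (hYQ (h ▸ hj))
  obtain ⟨M, hM⟩ := hI Y (iInf_ker_mem_edges l K) (lt_of_le_of_ne hXY hne)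
  obtain ⟨k, hk, hkQ⟩ := (hQ.prod_mem_iff).1 (hQ.mem_of_pow_mem M (hIQ hM))
  rw [Finset.mem_sdiff] at hk
  exact hk.2 (mem_indexSet.2 (iInf₂_le k (Finset.mem_filter.2 ⟨hk.1, hkQ⟩)))

/-- Since the forms `l_j`, `j ∈ J(X)`, span all forms vanishing on the edge `X` and generate a finitely
generated ideal, `linForm_mem_radical` holds with a uniform exponent. -/
theorem exists_prod_linForm_mem {X : Submodule ℂ (Fin n → ℂ)} (hX : X ∈ edges l)
    (I : Ideal (PolySX n d))
    (hI : ∀ Y ∈ edges l, X < Y →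
      ∃ M : ℕ, (∏ k ∈ indexSet l X \ indexSet l Y, linForm (l k)) ^ M ∈ I) :
    ∃ K : ℕ, ∀ L : List (Module.Dual ℂ (Fin n → ℂ)), (∀ φ ∈ L, φ ∈ X.dualAnnihilator) →
      L.length = K → (L.map linForm).prod ∈ I := by
  classical
  let m : Ideal (PolySX n d) :=
    Ideal.span ((indexSet l X).image fun k => (linForm (l k) : PolySX n d))
  have hm : m ≤ I.radical := by
    refine Ideal.span_le.2 fun p hp => ?_
    obtain ⟨k, hk, rfl⟩ := Finset.mem_image.1 hp
    exact linForm_mem_radical I hI hk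
  obtain ⟨K, hK⟩ := Ideal.exists_pow_le_of_le_radical_of_fg hm ⟨_, rfl⟩
  have hXm {φ : Module.Dual ℂ (Fin n → ℂ)} (hφ : φ ∈ X.dualAnnihilator) : linForm φ ∈ m := by
    have h : ⨅ k : indexSet l X, LinearMap.ker (l k) ≤ LinearMap.ker φ := by
      rw [iInf_subtype, iInf_indexSet_of_mem_edges hX]
      exact fun w hw => (Submodule.mem_dualAnnihilator _).1 hφ w hw
    refine linForm_mem_of_mem_span m ?_ (mem_span_of_iInf_ker_le_ker h)
    rintro _ ⟨k, rfl⟩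
    exact Ideal.subset_span (Finset.mem_image_of_mem _ k.2)
  refine ⟨K, fun L hL hLK => hK ?_⟩
  rw [← hLK]
  clear hLK hK
  induction L with
  | nil => simp
  | cons φ L ih =>
    rw [List.map_cons, List.prod_cons, List.length_cons, pow_succ']
    exact Ideal.mul_mem_mul (hXm (hL φ List.mem_cons_self))
      (ih fun ψ hψ => hL ψ (List.mem_cons_of_mem φ hψ))

/-- The functional equation of the subarrangement of an edge, realized by operators that
differentiate only in the directions of a subspace `W` transversal to the edge. The freedom in the
choice of `W` makes the operators for the two factors of a decomposable edge independent. -/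
theorem exists_edgeProd_mem_genModule (hl : ∀ j, l j ≠ 0) (a : Fin d → ℕ)
    (X : Submodule ℂ (Fin n → ℂ)) (hX : X ∈ edges l) (W : Submodule ℂ (Fin n → ℂ))
    (hW : W ⊔ X = ⊤) :
    ∃ N : ℕ, scal l (edgeProd l X N) ∈
      genModule l (indexSet l X) W (∏ k ∈ indexSet l X, arrElt l k ^ a k) := by
  classical
  induction X using WellFoundedGT.induction generalizing W with
  | ind X ih =>
  rcases eq_or_ne X ⊤ with rfl | hXtop
  · have h : indexSet l ⊤ = ∅ := Finset.eq_empty_of_forall_notMem fun j hj =>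
      hl j (LinearMap.ker_eq_top.1 (top_le_iff.1 (mem_indexSet.1 hj)))
    refine ⟨0, ?_⟩
    rw [h, Finset.prod_empty, ← mul_one (scal l _)]
    exact scal_mul_mem_genModule _ Gen.base
  by_cases hdec : IsDecomposable l X
  · obtain ⟨X₁, hX₁, X₂, hX₂, h₁, h₂, hinf, hsup, hJ⟩ := exists_edges_of_isDecomposable hX hdec
    have htrans {A B : Submodule ℂ (Fin n → ℂ)} (hAB : A ⊓ B = X) (hs : A ⊔ B = ⊤) :
        W ⊓ B ⊔ A = ⊤ := by
      have hXA : X ≤ A := hAB ▸ inf_le_left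
      have hXB : X ≤ B := hAB ▸ inf_le_right
      rw [eq_top_iff, ← hs]
      refine sup_le le_sup_right fun z hz => ?_
      obtain ⟨w, hw, x, hx, rfl⟩ := Submodule.mem_sup.1 (hW ▸ Submodule.mem_top : z ∈ W ⊔ X)
      refine Submodule.mem_sup.2 ⟨w, ⟨hw, ?_⟩, x, hXA hx, rfl⟩
      simpa using B.sub_mem hz (hXB hx)
    obtain ⟨N₁, hN₁⟩ := ih X₁ h₁ hX₁ (W ⊓ X₂) (htrans hinf hsup)
    obtain ⟨N₂, hN₂⟩ := ih X₂ h₂ hX₂ (W ⊓ X₁) (htrans (inf_comm X₁ X₂ ▸ hinf)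
      (sup_comm X₁ X₂ ▸ hsup))
    have hdisj : Disjoint (indexSet l X₁) (indexSet l X₂) := by
      refine Finset.disjoint_left.2 fun j hj₁ hj₂ => hl j (LinearMap.ker_eq_top.1 ?_)
      exact top_le_iff.1 (hsup ▸ sup_le (mem_indexSet.1 hj₁) (mem_indexSet.1 hj₂))
    refine ⟨max N₁ N₂, ?_⟩
    refine scal_mem_of_dvd (edgeProd_mul_dvd h₁.le h₂.le hsup _) ?_
    rw [← hJ]
    exact scal_mul_mem_genModule_union a hdisj inf_le_left inf_le_left
      (fun w hw k hk => mem_indexSet.1 hk hw.2) (fun w hw k hk => mem_indexSet.1 hk hw.2)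
      (scal_mem_of_dvd (edgeProd_dvd le_rfl (le_max_left _ _)) hN₁)
      (scal_mem_of_dvd (edgeProd_dvd le_rfl (le_max_right _ _)) hN₂)
  · have hXi : X ∈ indecEdges l := Finset.mem_filter.2 ⟨hX, hXtop, hdec⟩
    -- one exponent that serves all strictly larger edges
    have hN : ∃ N : ℕ, ∀ Y ∈ edges l, X < Y → scal l (edgeProd l Y N) ∈
        genModule l (indexSet l Y) W (∏ k ∈ indexSet l Y, arrElt l k ^ a k) := by
      have h (Y : Submodule ℂ (Fin n → ℂ)) : ∃ N : ℕ, Y ∈ edges l → X < Y →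
          scal l (edgeProd l Y N) ∈
            genModule l (indexSet l Y) W (∏ k ∈ indexSet l Y, arrElt l k ^ a k) := by
        by_cases hY : Y ∈ edges l ∧ X < Y
        · obtain ⟨N, hN⟩ := ih Y hY.2 hY.1 W
            (top_le_iff.1 (hW ▸ sup_le_sup_left hY.2.le W))
          exact ⟨N, fun _ _ => hN⟩
        · exact ⟨0, fun h h' => absurd ⟨h, h'⟩ hY⟩
      choose N hN using h
      exact ⟨(edges l).sup N, fun Y hY hXY =>
        scal_mem_of_dvd (edgeProd_dvd le_rfl (Finset.le_sup hY)) (hN Y hY hXY)⟩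
    obtain ⟨N, hN⟩ := hN
    set M := genModule l (indexSet l X) W (∏ k ∈ indexSet l X, arrElt l k ^ a k) with hM
    -- the part of the product that comes from the strictly larger edges
    let b (N : ℕ) : PolyS d := ∏ Y ∈ ((indecEdges l).filter (X ≤ ·)).erase X,
      ∏ m ∈ Finset.range (N + 1), edgeForm l Y m
    have hb (N : ℕ) : edgeProd l X N = b N * ∏ m ∈ Finset.range (N + 1), edgeForm l X m :=
      (Finset.prod_erase_mul _ _ (Finset.mem_filter.2 ⟨hXi, le_rfl⟩)).symm
    have hbY (Y : Submodule ℂ (Fin n → ℂ)) (hXY : X < Y) : edgeProd l Y N ∣ b N := by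
      refine Finset.prod_dvd_prod_of_subset _ _ _ fun Z hZ => ?_
      rw [Finset.mem_filter] at hZ
      exact Finset.mem_erase.2 ⟨(hXY.trans_le hZ.2).ne', Finset.mem_filter.2
        ⟨hZ.1, hXY.le.trans hZ.2⟩⟩
    let I : Ideal (PolySX n d) := M.comap (LinearMap.toSpanSingleton _ _ (scal l (b N)))
    have hI (p : PolySX n d) : p ∈ I ↔ algebraMap _ _ p * scal l (b N) ∈ M := by
      rw [Submodule.mem_comap, LinearMap.toSpanSingleton_apply, Algebra.smul_def]
    obtain ⟨K, hK⟩ := exists_prod_linForm_mem hX I fun Y hY hXY => by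
      obtain ⟨e, he⟩ := exists_pow_mul_mem_genModule a (indexSet_anti hXY.le)
        (scal_mem_of_dvd (hbY Y hXY) (hN Y hY hXY))
      exact ⟨e, (hI _).2 he⟩
    have hE := mul_prod_edgeForm_mem_genModule hW K fun L hL hLK => (hI _).1 (hK L hL hLK)
    refine ⟨max N K, scal_mem_of_dvd ?_ hE⟩
    rw [hb]
    refine mul_dvd_mul (Finset.prod_dvd_prod_of_dvd _ _ fun Y _ =>
      prod_edgeForm_dvd Y (Nat.succ_le_succ (le_max_left N K))) (prod_edgeForm_dvd X ?_)
    exact (le_max_right N K).trans (Nat.le_succ _)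

end BernsteinSato

theorem mainTheorem10 {n d : ℕ} (l : Fin d → Module.Dual ℂ (Fin n → ℂ)) (hl : ∀ j, l j ≠ 0)
    (a : Fin d → ℕ) :
    ∃ N : ℕ,
      (∏ X ∈ BernsteinSato.indecEdges l, ∏ ℓ ∈ Finset.range (N + 1),
        ((∑ j ∈ BernsteinSato.indexSet l X, MvPolynomial.X j) +
          MvPolynomial.C (BernsteinSato.rank X : ℂ) + MvPolynomial.C (ℓ : ℂ)) :
            MvPolynomial (Fin d) ℂ) ∈
        BernsteinSato.bsIdeal (fun j => BernsteinSato.formPoly (l j)) a := by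
  classical
  open BernsteinSato in
  -- the centre of the arrangement is contained in all edges
  set Z := ⨅ k ∈ (Finset.univ : Finset (Fin d)), LinearMap.ker (l k) with hZ
  have hZJ : indexSet l Z = Finset.univ :=
    Finset.eq_univ_of_forall fun j => mem_indexSet.2 (iInf₂_le j (Finset.mem_univ j))
  obtain ⟨N, hN⟩ := exists_edgeProd_mem_genModule hl a Z (iInf_ker_mem_edges l _) ⊤ (top_sup_eq Z)
  rw [hZJ] at hN
  obtain ⟨P, hP⟩ := exists_weylAct_of_mem_genModule l hN
  refine ⟨N, P, ?_⟩
  have hprod : edgeProd l Z N = ∏ X ∈ indecEdges l, ∏ m ∈ Finset.range (N + 1), edgeForm l X m := by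
    rw [edgeProd, Finset.filter_true_of_mem]
    intro Y hY
    obtain ⟨I, -, rfl⟩ := Finset.mem_image.1 (Finset.mem_filter.1 hY).1
    exact le_iInf₂ fun k _ => iInf₂_le k (Finset.mem_univ k)
  rw [hprod] at hP
  refine Eq.trans ?_ hP
  rw [Algebra.smul_def]
  simp [powS, edgeForm]
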